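/- All graphs and trees are finite. A family of pseudosegments is a family of Jordan arcs (injective continuous images of $[0,1]$) in the Euclidean plane such that any two of them are disjoint or meet in exactly one point, at which they cross; that is, some homeomorphism from a neighbourhood of that point onto an open neighbourhood of the origin in $\mathbb{R}^2$ sends the point to the origin and the two arcs, within that neighbourhood, to the two coordinate axes. A PSI-representation of a graph $G$ is a family of pseudosegments $(s_v)_{v\in V(G)}$ such that distinct vertices $v,w$ are adjacent if and only if $s_v\cap s_w\neq\emptyset$. A graph $G$ is a VPT-graph if there are a tree $T$ and paths $(P_v)_{v\in V(G)}$ in $T$ (single-vertex paths and repetitions are allowed) such that distinct $v,w$ are adjacent if and only if $P_v$ and $P_w$ have a common vertex. (1) Every VPT-graph has a PSI-representation. (2) Let $T$ be a tree with leaves (vertices of degree one) $l_1,\dots,l_m$, and for $1\le i\le j\le m$ let $P_{i,j}=P_{j,i}$ be the path in $T$ from $l_i$ to $l_j$ (so $P_{i,i}$ consists of $l_i$ only). Let $G$ be the vertex intersection graph of all the leaf-paths $P_{i,j}$. Then $G$ has a PSI-representation by pseudosegments $s_{i,j}=s_{j,i}$ corresponding to the paths $P_{i,j}$, and there are pairwise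 disjoint closed disks $R_1,\dots,R_m$ of positive radius such that: (a) $s_{i,j}\cap R_k\neq\emptyset$ if and only if $k=i$ or $k=j$; moreover $s_{i,j}\cap R_i$ and $s_{i,j}\cap R_j$ are Jordan arcs. (b) Any two distinct pseudosegments that intersect $R_i$ cross in the interior of $R_i$. -/

import Mathlib

/-- The intersection graph of a family of sets: distinct indices are adjacent exactly if
their sets meet. -/
def intersectionGraph {ι α : Type*} (S : ι → Set α) : SimpleGraph ι where
  Adj i j := i ≠ j ∧ (S i ∩ S j).Nonempty
  symm := ⟨fun _ _ h => ⟨h.1.symm, by rw [Set.inter_comm]; exact h.2⟩⟩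
  loopless := ⟨fun _ h => h.1 rfl⟩

/-- `P` is the vertex set of a path of `T` (paths with a single vertex are allowed). -/
def IsPathVertexSet {W : Type*} (T : SimpleGraph W) (P : Set W) : Prop :=
  ∃ (a b : W) (p : T.Walk a b), p.IsPath ∧ P = {w | w ∈ p.support}

/-- `G` is a VPT-graph: the vertex intersection graph of a family of paths in a finite tree. Since
finite trees are considered up to isomorphism, it is enough that the node set is a finite type
in the lowest universe. -/
def IsVPT {V : Type*} (G : SimpleGraph V) : Prop :=
  ∃ (W : Type) (_ : Finite W) (T : SimpleGraph W) (P : V → Set W),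
    T.IsTree ∧ (∀ v, IsPathVertexSet T (P v)) ∧ G = intersectionGraph P

/-- The Euclidean plane. -/
abbrev Plane : Type := EuclideanSpace ℝ (Fin 2)

/-- A Jordan arc: an injective continuous image of the unit interval. -/
def IsJordanArc (A : Set Plane) : Prop :=
  ∃ γ : unitInterval → Plane, Continuous γ ∧ Function.Injective γ ∧ Set.range γ = A

/-- `A` and `B` cross at `x`: some local homeomorphism around `x` that sends `x` to the origin
straightens `A` to the horizontal and `B` to the vertical coordinate axis. In particular `x` is an
inner point of both arcs, and each arc passes there from one side of the other to the other. -/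
def CrossAt (A B : Set Plane) (x : Plane) : Prop :=
  ∃ φ : OpenPartialHomeomorph Plane Plane, x ∈ φ.source ∧ φ x = 0 ∧
    ∀ y ∈ φ.source, (y ∈ A ↔ φ y 1 = 0) ∧ (y ∈ B ↔ φ y 0 = 0)

/-- A family of pseudosegments: Jordan arcs in the plane any two of which are disjoint or meet
in a single point and cross there. -/
def IsPseudosegmentFamily {ι : Type*} (s : ι → Set Plane) : Prop :=
  (∀ i, IsJordanArc (s i)) ∧
    ∀ i j, i ≠ j → Disjoint (s i) (s j) ∨ ∃ x, s i ∩ s j = {x} ∧ CrossAt (s i) (s j) x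

/-- The family `s` is a PSI-representation of `G`. -/
def IsPSIRepresentation {V : Type*} (G : SimpleGraph V) (s : V → Set Plane) : Prop :=
  IsPseudosegmentFamily s ∧ G = intersectionGraph s

/-- The leaves of a tree: the nodes with exactly one neighbour. -/
abbrev Leaf {W : Type*} (T : SimpleGraph W) : Type _ := {l : W // ∃! w, T.Adj l w}

/-- For an unordered pair `e` of (possibly equal) leaves of the tree `T`, the vertex set of the
path of `T` that joins them. -/
def leafPath {W : Type*} (T : SimpleGraph W) (e : Sym2 (Leaf T)) : Set W :=
  {w | ∃ (a b : Leaf T) (p : T.Walk a.1 b.1), e = s(a, b) ∧ p.IsPath ∧ w ∈ p.support}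

/-! Label `i` becomes the point `(t i, t i ^ 2)` of a parabola, and the path joining labels `i` and
`j` becomes a piece of the secant through their two points (the tangent if `i = j`), of slope `t i +
t j` and intercept `-(t i * t j)`. The lines through the point of `k` are exactly those of the pairs
containing `k`; small disks around these points then give (a) and (b).

It remains to cut the secants so that they meet exactly when the paths do. Root the tree. A path has
a least node, the greatest common ancestor `a` of its ends, called its meet; two paths share a node
iff the meet of one lies on the other. The secant is kept over the interval of radius `ρ a` around
`τ a`. By `exists_forest_positions`, positions can be chosen on widely separated scales, so that
labels above `a` are close to `τ a` compared with `ρ a` and all others are far away.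

The parabola exceeds a secant at `x` by `(x - t i) * (x - t j)`, so crossings are decided by
comparing such products. Against a secant with both labels near `τ a`, one with two, one or no
labels near it crosses, crosses or misses respectively (`secants_cross_of_near`,
`secants_cross_of_near_far`, `secants_ne_of_near_far_far`). `exists_secant_system` matches these
cases with the positions of the meets. Part (2) takes the leaves as labels, part (1) two private
labels for each path. -/

namespace SimpleGraph

/-! ### The ancestor order of a rooted tree -/

variable {W : Type*} {T : SimpleGraph W}

/-- `a` is an ancestor of `b` with respect to the root `r`: it lies on a path from `r` to `b`. -/
def Ancestor (T : SimpleGraph W) (r a b : W) : Prop :=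
  ∃ p : T.Walk r b, p.IsPath ∧ a ∈ p.support

theorem IsTree.ancestor_iff (hT : T.IsTree) {r a b : W} {p : T.Walk r b} (hp : p.IsPath) :
    T.Ancestor r a b ↔ a ∈ p.support := by
  constructor
  · rintro ⟨q, hq, ha⟩
    rwa [(hT.existsUnique_path r b).unique hp hq]
  · exact fun h => ⟨p, hp, h⟩

theorem IsTree.ancestor_refl (hT : T.IsTree) (r a : W) : T.Ancestor r a a := by
  obtain ⟨p, hp, -⟩ := hT.existsUnique_path r a
  exact ⟨p, hp, p.end_mem_support⟩

theorem IsTree.ancestor_root (hT : T.IsTree) (r a : W) : T.Ancestor r r a := by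
  obtain ⟨p, hp, -⟩ := hT.existsUnique_path r a
  exact ⟨p, hp, p.start_mem_support⟩

theorem IsTree.ancestor_trans (hT : T.IsTree) {r a b c : W} (hab : T.Ancestor r a b)
    (hbc : T.Ancestor r b c) : T.Ancestor r a c := by
  classical
  obtain ⟨p, hp, hb⟩ := hbc
  rw [hT.ancestor_iff (hp.takeUntil hb)] at hab
  exact ⟨p, hp, p.support_takeUntil_subset_support hb hab⟩

theorem IsTree.ancestor_antisymm (hT : T.IsTree) {r a b : W} (hab : T.Ancestor r a b)
    (hba : T.Ancestor r b a) : a = b := by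
  classical
  obtain ⟨p, hp, ha⟩ := hab
  by_contra hne
  rw [hT.ancestor_iff (hp.takeUntil ha)] at hba
  exact Walk.endpoint_notMem_support_takeUntil hp ha (Ne.symm hne) hba

theorem IsTree.mem_support_append_iff_ancestor (hT : T.IsTree) {r a u w : W} {q : T.Walk r a}
    {s : T.Walk a u} (h : (q.append s).IsPath) :
    w ∈ s.support ↔ T.Ancestor r a w ∧ T.Ancestor r w u := by
  classical
  constructor
  · intro hw
    have hs : (q.append (s.takeUntil w hw)).append (s.dropUntil w hw) = q.append s := by
      rw [← Walk.append_assoc, Walk.take_spec]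
    refine ⟨⟨q.append (s.takeUntil w hw), ?_, ?_⟩, q.append s, h, ?_⟩
    · rw [← hs] at h
      exact h.of_append_left
    · simp [Walk.mem_support_append_iff]
    · simp [Walk.mem_support_append_iff, hw]
  · rintro ⟨haw, hwu⟩
    rw [hT.ancestor_iff h, Walk.mem_support_append_iff] at hwu
    rcases hwu with hw | hw
    · have := hT.ancestor_antisymm ⟨q, h.of_append_left, hw⟩ haw
      subst this
      exact s.start_mem_support
    · exact hw

theorem IsTree.ancestor_total (hT : T.IsTree) {r a b c : W} (hac : T.Ancestor r a c)
    (hbc : T.Ancestor r b c) : T.Ancestor r a b ∨ T.Ancestor r b a := by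
  classical
  obtain ⟨p, hp, ha⟩ := hac
  rw [hT.ancestor_iff hp] at hbc
  have hp' := hp
  rw [← p.take_spec ha] at hbc hp'
  rw [Walk.mem_support_append_iff] at hbc
  rcases hbc with hb | hb
  · exact .inr ⟨_, hp.takeUntil ha, hb⟩
  · exact .inl ((hT.mem_support_append_iff_ancestor hp').1 hb).1

/-- The tree order with root `r`: `a ≤ b` if `a` lies on the path from `r` to `b`. -/
abbrev IsTree.rootedOrder (hT : T.IsTree) (r : W) : PartialOrder W where
  le := T.Ancestor r
  le_refl := hT.ancestor_refl r
  le_trans _ _ _ := hT.ancestor_trans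
  le_antisymm _ _ := hT.ancestor_antisymm

theorem IsTree.exists_isGreatest_ancestor (hT : T.IsTree) [Finite W] (r u v : W) :
    ∃ a, T.Ancestor r a u ∧ T.Ancestor r a v ∧
      ∀ c, T.Ancestor r c u → T.Ancestor r c v → T.Ancestor r c a := by
  let _ := hT.rootedOrder r
  obtain ⟨a, ha⟩ := (Set.toFinite {c | T.Ancestor r c u ∧ T.Ancestor r c v}).exists_maximal
    ⟨r, hT.ancestor_root r u, hT.ancestor_root r v⟩
  refine ⟨a, ha.1.1, ha.1.2, fun c hu hv => ?_⟩
  rcases hT.ancestor_total hu ha.1.1 with h | h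
  · exact h
  · exact ha.2 ⟨hu, hv⟩ h

/-- The branches from `a` to `u` and to `v` share only `a`, since a common node is a common ancestor
and so lies below `a`. Their concatenation is therefore the unique path from `u` to `v`. -/
theorem IsTree.mem_support_iff_ancestor (hT : T.IsTree) {r a u v w : W}
    (hu : T.Ancestor r a u) (hv : T.Ancestor r a v)
    (ha : ∀ c, T.Ancestor r c u → T.Ancestor r c v → T.Ancestor r c a)
    {p : T.Walk u v} (hp : p.IsPath) :
    w ∈ p.support ↔ T.Ancestor r a w ∧ (T.Ancestor r w u ∨ T.Ancestor r w v) := by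
  classical
  obtain ⟨p₁, hp₁, ha₁⟩ := hu
  obtain ⟨p₂, hp₂, ha₂⟩ := hv
  have e₁ := hp₁
  have e₂ := hp₂
  rw [← p₁.take_spec ha₁] at e₁
  rw [← p₂.take_spec ha₂] at e₂
  have m₁ := fun x => hT.mem_support_append_iff_ancestor (w := x) e₁
  have m₂ := fun x => hT.mem_support_append_iff_ancestor (w := x) e₂
  have hpath : ((p₁.dropUntil a ha₁).reverse.append (p₂.dropUntil a ha₂)).IsPath := by
    rw [Walk.isPath_def, Walk.support_append, List.nodup_append']
    refine ⟨e₁.of_append_right.reverse.support_nodup, e₂.of_append_right.support_nodup.tail, ?_⟩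
    intro x hx hx'
    rw [Walk.support_reverse, List.mem_reverse, m₁] at hx
    have hx2 := (m₂ x).1 (List.mem_of_mem_tail hx')
    have : x = a := hT.ancestor_antisymm (ha x hx.2 hx2.2) hx.1
    subst this
    have hn := e₂.of_append_right.support_nodup
    rw [← Walk.cons_tail_support] at hn
    exact (List.nodup_cons.1 hn).1 hx'
  rw [(hT.existsUnique_path u v).unique hp hpath, Walk.mem_support_append_iff,
    Walk.support_reverse, List.mem_reverse, m₁, m₂, and_or_left]

end SimpleGraph

/-! ### Scales and positions of the nodes -/

/-- A sequence growing fast enough to serve as a hierarchy of scales. -/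
def scale : ℕ → ℝ
  | 0 => 1
  | n + 1 => 64 * scale n ^ 2

theorem one_le_scale (n : ℕ) : 1 ≤ scale n := by
  induction n with
  | zero => simp [scale]
  | succ n ih => rw [scale]; nlinarith

theorem scale_succ_ge (n : ℕ) : 64 * scale n ≤ scale (n + 1) := by
  rw [scale]; nlinarith [one_le_scale n]

theorem scale_mono : Monotone scale :=
  monotone_nat_of_le_succ fun n => by linarith [scale_succ_ge n, one_le_scale n]

/-- Odd indices serve as displacements, even ones as radii. Squaring in the recursion lets a radius
dominate even the square of the sum of all smaller displacements, as `secants_cross_of_near`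
requires. -/
theorem sum_scale_odd_bounds (n : ℕ) :
    0 ≤ ∑ m ∈ Finset.range n, scale (2 * m + 1) ∧
    8 * ∑ m ∈ Finset.range n, scale (2 * m + 1) ≤ scale (2 * n) ∧
    4 * (∑ m ∈ Finset.range n, scale (2 * m + 1)) ^ 2 < scale (2 * n) := by
  induction n with
  | zero => simp [scale]
  | succ n ih =>
    rw [Finset.sum_range_succ]
    obtain ⟨h0, h1, -⟩ := ih
    have h2 := scale_succ_ge (2 * n)
    have h3 := scale_succ_ge (2 * n + 1)
    have h4 := one_le_scale (2 * n + 1)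
    have h5 : scale (2 * (n + 1)) = 64 * scale (2 * n + 1) ^ 2 := by
      rw [show 2 * (n + 1) = 2 * n + 1 + 1 by ring, scale]
    rw [show 2 * n + 1 + 1 = 2 * (n + 1) by ring] at h3
    generalize ∑ m ∈ Finset.range n, scale (2 * m + 1) = S at *
    refine ⟨by linarith, by linarith [one_le_scale (2 * n)], ?_⟩
    rw [h5]
    have : S + scale (2 * n + 1) ≤ 2 * scale (2 * n + 1) := by linarith [one_le_scale (2 * n)]
    nlinarith

theorem sum_scale_le_of_injective {N : Type*} {κ : N → ℕ} (hκ : κ.Injective) (s : Finset N) (n : ℕ)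
    (hs : ∀ u ∈ s, κ u < n) :
    ∑ u ∈ s, scale (2 * κ u + 1) ≤ ∑ m ∈ Finset.range n, scale (2 * m + 1) := by
  classical
  rw [← Finset.sum_image (f := fun m => scale (2 * m + 1)) (g := κ) (hκ.injOn)]
  refine Finset.sum_le_sum_of_subset_of_nonneg ?_ fun m _ _ => by linarith [one_le_scale (2 * m + 1)]
  intro m hm
  obtain ⟨u, hu, rfl⟩ := Finset.mem_image.1 hm
  exact Finset.mem_range.2 (hs u hu)

/-- The nonzero term of largest `κ` outweighs all the others together. The bound 2 admits the
coefficients of `τ i + τ j - τ k - τ l`. -/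
theorem half_scale_le_abs_sum {N : Type*} [Fintype N] {κ : N → ℕ} (hκ : κ.Injective)
    (c : N → ℤ) (hc : ∀ u, |c u| ≤ 2) {v : N} (hv : c v ≠ 0) :
    scale (2 * κ v + 1) / 2 ≤ |∑ u, (c u : ℝ) * scale (2 * κ u + 1)| := by
  classical
  obtain ⟨w, hw, hmax⟩ := (Finset.univ.filter fun u => c u ≠ 0).exists_max_image κ
    ⟨v, by simpa using hv⟩
  simp only [Finset.mem_filter, Finset.mem_univ, true_and] at hw hmax
  have hsum : |∑ u ∈ Finset.univ.erase w, (c u : ℝ) * scale (2 * κ u + 1)| ≤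
      2 * ∑ m ∈ Finset.range (κ w), scale (2 * m + 1) := by
    refine (Finset.abs_sum_le_sum_abs _ _).trans ?_
    refine le_trans ?_ (mul_le_mul_of_nonneg_left (sum_scale_le_of_injective hκ
      ((Finset.univ.erase w).filter fun u => c u ≠ 0) (κ w) ?_) zero_le_two)
    · rw [Finset.mul_sum, Finset.sum_filter]
      refine Finset.sum_le_sum fun u _ => ?_
      have h1 := one_le_scale (2 * κ u + 1)
      split_ifs with h
      · rw [abs_mul, abs_of_pos (by linarith : 0 < scale (2 * κ u + 1))]
        have : |(c u : ℝ)| ≤ 2 := by exact_mod_cast hc u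
        nlinarith
      · simp only [not_not] at h
        simp [h]
    · intro u hu
      simp only [Finset.mem_filter, Finset.mem_erase, Finset.mem_univ, and_true] at hu
      exact lt_of_le_of_ne (hmax u hu.2) fun h => hu.1 (hκ h)
  rw [← Finset.add_sum_erase _ _ (Finset.mem_univ w)]
  have h1 : (1 : ℝ) ≤ |(c w : ℝ)| := by exact_mod_cast Int.one_le_abs hw
  have h2 := scale_mono (show 2 * κ v + 1 ≤ 2 * κ w + 1 by have := hmax v hv; omega)
  have h3 := (sum_scale_odd_bounds (κ w)).2.1
  have h4 := scale_succ_ge (2 * κ w)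
  have h5 := one_le_scale (2 * κ w)
  have h6 : scale (2 * κ w + 1) ≤ |(c w : ℝ) * scale (2 * κ w + 1)| := by
    rw [abs_mul, abs_of_pos (by linarith : 0 < scale (2 * κ w + 1))]
    nlinarith
  have h7 := abs_sub_abs_le_abs_add ((c w : ℝ) * scale (2 * κ w + 1))
    (∑ u ∈ Finset.univ.erase w, (c u : ℝ) * scale (2 * κ u + 1))
  linarith

theorem exists_injective_strictAnti_nat (N : Type*) [Finite N] [PartialOrder N] :
    ∃ κ : N → ℕ, κ.Injective ∧ StrictAnti κ := by
  classical
  have := Fintype.ofFinite N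
  -- The order is reversed so that nodes nearer the root receive larger scales.
  have : Fintype (LinearExtension Nᵒᵈ) := ‹Fintype N›
  let f := Fintype.orderIsoFinOfCardEq (LinearExtension Nᵒᵈ) rfl
  have hinj : Function.Injective fun n : N => (f.symm (toLinearExtension (OrderDual.toDual n)) : ℕ) :=
    fun a b h => f.symm.injective (Fin.ext h)
  refine ⟨_, hinj, fun a b hab => lt_of_le_of_ne ?_ fun h => hab.ne' (hinj h)⟩
  exact f.symm.monotone (toLinearExtension.monotone (OrderDual.toDual_le_toDual.2 hab.le))

/-- Positions `τ` and radii `ρ` for the nodes of a finite forest order: the intervals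
`[τ a - ρ a, τ a + ρ a]` form a laminar family that reflects the order, and the
positions of maximal nodes have distinct pairwise sums. -/
theorem exists_forest_positions (N : Type*) [Finite N] [PartialOrder N]
    (htotal : ∀ a b c : N, a ≤ c → b ≤ c → a ≤ b ∨ b ≤ a) :
    ∃ τ ρ : N → ℝ, (∀ a, 1 ≤ ρ a) ∧
      (∀ a n, a ≤ n → 4 * |τ n - τ a| ≤ ρ a ∧ 4 * (τ n - τ a) ^ 2 < ρ a) ∧
      (∀ a n, ¬ a ≤ n → 8 * ρ a < |τ n - τ a|) ∧
      (∀ a b, a < b → |τ b - τ a| + ρ b < ρ a) ∧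
      (∀ i j k l, IsMax i → IsMax j → IsMax k → IsMax l → s(i, j) ≠ s(k, l) →
        1 ≤ |τ i + τ j - τ k - τ l|) := by
  classical
  have := Fintype.ofFinite N
  obtain ⟨κ, hκ, hanti⟩ := exists_injective_strictAnti_nat N
  -- Each node `u` displaces everything above it by `scale (2 * κ u + 1)`.
  let ind : N → N → ℤ := fun n u => if u ≤ n then 1 else 0
  let τ : N → ℝ := fun n => ∑ u, (ind n u : ℝ) * scale (2 * κ u + 1)
  -- Displacements by nodes below `a` cancel. The other nodes below `n` are comparable with `a`,
  -- hence strictly above it, and have smaller `κ`.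
  have hle : ∀ a n, a ≤ n → |τ n - τ a| ≤ ∑ m ∈ Finset.range (κ a), scale (2 * m + 1) := by
    intro a n han
    have key : τ n - τ a =
        ∑ u ∈ Finset.univ.filter (fun u => u ≤ n ∧ ¬ u ≤ a), scale (2 * κ u + 1) := by
      simp only [τ, ind, ← Finset.sum_sub_distrib, Finset.sum_filter]
      refine Finset.sum_congr rfl fun u _ => ?_
      by_cases h1 : u ≤ a
      · simp [h1, h1.trans han]
      · by_cases h2 : u ≤ n <;> simp [h1, h2]
    rw [key, abs_of_nonneg (Finset.sum_nonneg fun u _ => by linarith [one_le_scale (2 * κ u + 1)])]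
    refine sum_scale_le_of_injective hκ _ _ fun u hu => ?_
    simp only [Finset.mem_filter, Finset.mem_univ, true_and] at hu
    rcases htotal _ _ _ hu.1 han with h | h
    · exact absurd h hu.2
    · exact hanti (lt_of_le_not_ge h hu.2)
  have hquarter : ∀ a n, a ≤ n → 8 * |τ n - τ a| ≤ scale (2 * κ a) := fun a n h => by
    linarith [hle a n h, (sum_scale_odd_bounds (κ a)).2.1]
  refine ⟨τ, fun a => scale (2 * κ a), fun a => one_le_scale _, fun a n h => ⟨?_, ?_⟩,
    fun a n h => ?_, fun a b h => ?_, fun i j k l hi hj hk hl hne => ?_⟩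
  · linarith [hquarter a n h, abs_nonneg (τ n - τ a)]
  · have h1 := hle a n h
    have h2 := (sum_scale_odd_bounds (κ a)).2.2
    rw [← sq_abs]
    nlinarith [abs_nonneg (τ n - τ a)]
  · have hkey := half_scale_le_abs_sum hκ (fun u => ind n u - ind a u)
      (fun u => by simp only [ind]; split_ifs <;> simp) (v := a) (by simp [ind, h])
    have : ∑ u, ((ind n u - ind a u : ℤ) : ℝ) * scale (2 * κ u + 1) = τ n - τ a := by
      simp only [τ, ← Finset.sum_sub_distrib]
      exact Finset.sum_congr rfl fun u _ => by push_cast; ring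
    rw [this] at hkey
    linarith [scale_succ_ge (2 * κ a), one_le_scale (2 * κ a)]
  · have h1 := hquarter a b h.le
    have h2 := scale_mono (show 2 * κ b + 1 ≤ 2 * κ a by have := hanti h; omega)
    linarith [scale_succ_ge (2 * κ b), one_le_scale (2 * κ b), abs_nonneg (τ b - τ a)]
  -- At a maximal node the coefficient just counts occurrences among `i, j` minus those among `k,
  -- l`; if all coefficients vanished, the two pairs would agree.
  · have hmax : ∀ u n, IsMax u → ind n u = if u = n then 1 else 0 := by
      intro u n hu
      have : u ≤ n ↔ u = n := ⟨fun h => hu.eq_of_le h, fun h => h.le⟩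
      simp [ind, this]
    obtain ⟨v, hv⟩ : ∃ v, ind i v + ind j v - ind k v - ind l v ≠ 0 := by
      by_contra! hall
      apply hne
      have hi' := hall i
      have hj' := hall j
      have hk' := hall k
      rw [hmax _ _ hi, hmax _ _ hi, hmax _ _ hi, hmax _ _ hi] at hi'
      rw [hmax _ _ hj, hmax _ _ hj, hmax _ _ hj, hmax _ _ hj] at hj'
      rw [hmax _ _ hk, hmax _ _ hk, hmax _ _ hk, hmax _ _ hk] at hk'
      rw [Sym2.eq_iff]
      by_cases h1 : i = k <;> by_cases h2 : i = l <;> by_cases h3 : j = k <;>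
        by_cases h4 : j = l <;> by_cases h5 : i = j <;> by_cases h6 : k = l <;> grind
    have hkey := half_scale_le_abs_sum hκ (fun u => ind i u + ind j u - ind k u - ind l u)
      (fun u => by simp only [ind]; split_ifs <;> simp) hv
    have : ∑ u, ((ind i u + ind j u - ind k u - ind l u : ℤ) : ℝ) * scale (2 * κ u + 1) =
        τ i + τ j - τ k - τ l := by
      simp only [τ, ← Finset.sum_sub_distrib, ← Finset.sum_add_distrib]
      exact Finset.sum_congr rfl fun u _ => by push_cast; ring
    rw [this] at hkey
    linarith [scale_succ_ge (2 * κ v), one_le_scale (2 * κ v)]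

/-! ### Crossings of secants of a parabola -/

theorem exists_root_of_mul_neg {α β p q : ℝ} (hpq : p < q)
    (h : (α * p + β) * (α * q + β) < 0) : α ≠ 0 ∧ ∃ x, p < x ∧ x < q ∧ α * x + β = 0 := by
  have hα : α ≠ 0 := by
    rintro rfl
    nlinarith [sq_nonneg β]
  refine ⟨hα, -β / α, ?_⟩
  have e : α * (-β / α) + β = 0 := by field_simp; ring
  have hβ : β = -(α * (-β / α)) := by linarith
  generalize -β / α = x at *
  subst hβ
  have hα2 : 0 < α ^ 2 := by positivity
  have h' : α ^ 2 * ((p - x) * (q - x)) < 0 := by linarith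
  have h'' : (p - x) * (q - x) < 0 := by
    by_contra! h0
    nlinarith [mul_nonneg hα2.le h0]
  refine ⟨?_, ?_, by ring⟩ <;> by_contra! h0 <;> nlinarith

section Secants

variable {ti tj tk tl c ρ : ℝ}

/-- Two secants of the parabola with all four nodes close to `c` cross over the interval of
radius `ρ` around `c`. -/
theorem secants_cross_of_near
    (hi : 4 * (ti - c) ^ 2 < ρ) (hj : 4 * (tj - c) ^ 2 < ρ)
    (hk : 4 * (tk - c) ^ 2 < ρ) (hl : 4 * (tl - c) ^ 2 < ρ)
    (hs : 1 ≤ |ti + tj - tk - tl|) :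
    ti + tj ≠ tk + tl ∧
      ∃ x, |x - c| < ρ ∧ (ti + tj) * x - ti * tj = (tk + tl) * x - tk * tl := by
  obtain ⟨a, rfl⟩ : ∃ a, ti = c + a := ⟨ti - c, by ring⟩
  obtain ⟨b, rfl⟩ : ∃ a, tj = c + a := ⟨tj - c, by ring⟩
  obtain ⟨d, rfl⟩ : ∃ a, tk = c + a := ⟨tk - c, by ring⟩
  obtain ⟨e, rfl⟩ : ∃ a, tl = c + a := ⟨tl - c, by ring⟩
  simp only [add_sub_cancel_left] at hi hj hk hl
  rw [show c + a + (c + b) - (c + d) - (c + e) = a + b - d - e by ring] at hs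
  have hσ : a + b - d - e ≠ 0 := by
    intro h
    rw [h] at hs
    norm_num at hs
  have hx : (a + b - d - e) * ((a * b - d * e) / (a + b - d - e)) = a * b - d * e := by field_simp
  refine ⟨fun h => hσ (by linarith), c + (a * b - d * e) / (a + b - d - e), ?_, ?_⟩
  · rw [add_sub_cancel_left, abs_div, div_lt_iff₀ (by linarith)]
    have h1 : |a * b - d * e| < ρ := by
      rw [abs_lt]
      constructor <;> nlinarith [sq_nonneg (a - b), sq_nonneg (a + b), sq_nonneg (d - e),
        sq_nonneg (d + e)]
    nlinarith [sq_nonneg a]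
  · linear_combination hx

/-- A secant with both nodes close to `c` crosses every secant with exactly one node
close to `c`. -/
theorem secants_cross_of_near_far (hρ : 0 < ρ)
    (hi : 4 * |ti - c| ≤ ρ) (hj : 4 * |tj - c| ≤ ρ) (hk : 4 * |tk - c| ≤ ρ)
    (hl : 8 * ρ < |tl - c|) :
    ti + tj ≠ tk + tl ∧
      ∃ x, |x - c| < ρ ∧ (ti + tj) * x - ti * tj = (tk + tl) * x - tk * tl := by
  obtain ⟨a, rfl⟩ : ∃ a, ti = c + a := ⟨ti - c, by ring⟩
  obtain ⟨b, rfl⟩ : ∃ a, tj = c + a := ⟨tj - c, by ring⟩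
  obtain ⟨d, rfl⟩ : ∃ a, tk = c + a := ⟨tk - c, by ring⟩
  obtain ⟨e, rfl⟩ : ∃ a, tl = c + a := ⟨tl - c, by ring⟩
  simp only [add_sub_cancel_left] at hi hj hk hl
  have ha := abs_le.1 (show |a| ≤ ρ / 4 by linarith)
  have hb := abs_le.1 (show |b| ≤ ρ / 4 by linarith)
  have hd := abs_le.1 (show |d| ≤ ρ / 4 by linarith)
  have A1 : 0 < (ρ - a) * (ρ - b) := mul_pos (by linarith) (by linarith)
  have A2 : (ρ - a) * (ρ - b) ≤ 5 / 4 * ρ * (5 / 4 * ρ) :=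
    mul_le_mul (by linarith) (by linarith) (by linarith) (by linarith)
  have B1 : 0 < (ρ + a) * (ρ + b) := mul_pos (by linarith) (by linarith)
  have B2 : (ρ + a) * (ρ + b) ≤ 5 / 4 * ρ * (5 / 4 * ρ) :=
    mul_le_mul (by linarith) (by linarith) (by linarith) (by linarith)
  have hsq : 0 < ρ * ρ := mul_pos hρ hρ
  -- The difference of the secants at offset `y` is `(y - d) * (y - e) - (y - a) * (y - b)`. At `y =
  -- ±ρ` the second product lies between 0 and `25/16 * ρ ^ 2`, while the first is at least `6 * ρ ^
  -- 2` at one end and negative at the other.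
  have hneg : ((a + b - d - e) * (-ρ) + (d * e - a * b)) *
      ((a + b - d - e) * ρ + (d * e - a * b)) < 0 := by
    have e1 : (a + b - d - e) * (-ρ) + (d * e - a * b) =
      (ρ + d) * (ρ + e) - (ρ + a) * (ρ + b) := by ring
    have e2 : (a + b - d - e) * ρ + (d * e - a * b) =
      (ρ - d) * (ρ - e) - (ρ - a) * (ρ - b) := by ring
    rw [e1, e2]
    rcases lt_abs.1 hl with h | h
    · have C : 3 / 4 * ρ * (8 * ρ) ≤ (ρ + d) * (ρ + e) :=
        mul_le_mul (by linarith) (by linarith) (by linarith) (by linarith)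
      have D : (ρ - d) * (ρ - e) < 0 := mul_neg_of_pos_of_neg (by linarith) (by linarith)
      exact mul_neg_of_pos_of_neg (by linarith) (by linarith)
    · have C : 3 / 4 * ρ * (8 * ρ) ≤ (ρ - d) * (ρ - e) :=
        mul_le_mul (by linarith) (by linarith) (by linarith) (by linarith)
      have D : (ρ + d) * (ρ + e) < 0 := mul_neg_of_pos_of_neg (by linarith) (by linarith)
      exact mul_neg_of_neg_of_pos (by linarith) (by linarith)
  obtain ⟨hα, x, h1, h2, hx⟩ := exists_root_of_mul_neg (by linarith) hneg
  refine ⟨fun h => hα (by linarith), c + x, ?_, by linear_combination hx⟩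
  rw [add_sub_cancel_left, abs_lt]
  exact ⟨h1, h2⟩

/-- A secant with both nodes close to `c` misses every secant with both nodes far from `c`. -/
theorem secants_ne_of_near_far_far (hρ : 0 < ρ) (hi : 4 * |ti - c| ≤ ρ) (hj : 4 * |tj - c| ≤ ρ)
    (hk : 8 * ρ < |tk - c|) (hl : 8 * ρ < |tl - c|) {x : ℝ} (hx : |x - c| ≤ ρ) :
    (ti + tj) * x - ti * tj ≠ (tk + tl) * x - tk * tl := by
  intro h
  -- The left side is at most `4 * ρ ^ 2`, the right side at least `49 * ρ ^ 2`.
  have h' : |x - ti| * |x - tj| = |x - tk| * |x - tl| := by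
    rw [← abs_mul, ← abs_mul]
    congr 1
    linarith
  have h1 : |x - ti| ≤ 2 * ρ := by
    linarith [abs_sub_le x c ti, abs_sub_comm c ti, abs_nonneg (ti - c)]
  have h2 : |x - tj| ≤ 2 * ρ := by
    linarith [abs_sub_le x c tj, abs_sub_comm c tj, abs_nonneg (tj - c)]
  have h3 : 7 * ρ ≤ |x - tk| := by linarith [abs_sub_le tk x c, abs_sub_comm x tk]
  have h4 : 7 * ρ ≤ |x - tl| := by linarith [abs_sub_le tl x c, abs_sub_comm x tl]
  have h5 := mul_le_mul h1 h2 (abs_nonneg _) (by linarith)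
  have h6 := mul_le_mul h3 h4 (by linarith) (abs_nonneg _)
  nlinarith [mul_pos hρ hρ]

end Secants

/-! ### Segments as Jordan arcs and their crossings -/

/-- The segment over the interval of radius `ρ` around `c` of the line with slope `m` and
intercept `q`. -/
def lineSegment (m q c ρ : ℝ) : Set Plane :=
  {p | |p 0 - c| ≤ ρ ∧ p 1 = m * p 0 + q}

theorem isClosed_lineSegment (m q c ρ : ℝ) : IsClosed (lineSegment m q c ρ) := by
  refine IsClosed.and (isClosed_le ?_ ?_) (isClosed_eq ?_ ?_) <;> fun_prop

theorem isJordanArc_graph_Icc {m q a b : ℝ} (hab : a < b) :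
    IsJordanArc {p : Plane | p 0 ∈ Set.Icc a b ∧ p 1 = m * p 0 + q} := by
  refine ⟨fun u => !₂[a + u * (b - a), m * (a + u * (b - a)) + q], by fun_prop, ?_, ?_⟩
  · intro u v h
    have h0 := congrArg (fun p : Plane => p 0) h
    simp only [Matrix.cons_val_zero, add_right_inj] at h0
    exact Subtype.ext (mul_right_cancel₀ (sub_ne_zero.2 hab.ne') h0)
  · ext p
    constructor
    · rintro ⟨u, rfl⟩
      have := u.2.1
      have := u.2.2
      simp only [Set.mem_ofPred_eq, Matrix.cons_val_zero, Matrix.cons_val_one,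
        and_true, Set.mem_Icc]
      constructor <;> nlinarith
    · rintro ⟨⟨h1, h2⟩, h3⟩
      have hne : b - a ≠ 0 := sub_ne_zero.2 hab.ne'
      refine ⟨⟨(p 0 - a) / (b - a), div_nonneg (by linarith) (by linarith),
        (div_le_one (by linarith)).2 (by linarith)⟩, ?_⟩
      ext n
      fin_cases n
      · simp [hne]
      · simp [hne, h3]

theorem isJordanArc_lineSegment {m q c ρ : ℝ} (hρ : 0 < ρ) :
    IsJordanArc (lineSegment m q c ρ) := by
  convert isJordanArc_graph_Icc (m := m) (q := q) (show c - ρ < c + ρ by linarith) using 1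
  ext p
  simp only [lineSegment, Set.mem_ofPred_eq, Set.mem_Icc, abs_le, and_congr_left_iff]
  intro _
  constructor <;> rintro ⟨h1, h2⟩ <;> constructor <;> linarith

/-- Distances along the line are `√(1 + m ^ 2)` times horizontal ones, so the disk selects an
interval of abscissae around `z 0`. Strictness in `hz` keeps the overlap from shrinking to a point.
-/
theorem isJordanArc_lineSegment_inter_closedBall {m q c ρ r : ℝ} (hr : 0 < r) {z : Plane}
    (hz : |z 0 - c| < ρ) (hz' : z 1 = m * z 0 + q) :
    IsJordanArc (lineSegment m q c ρ ∩ Metric.closedBall z r) := by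
  have hpos : 0 < √(1 + m ^ 2) := Real.sqrt_pos.2 (by positivity)
  have hr' : 0 < r / √(1 + m ^ 2) := div_pos hr hpos
  obtain ⟨hz1, hz2⟩ := abs_lt.1 hz
  have hlt : max (c - ρ) (z 0 - r / √(1 + m ^ 2)) < min (c + ρ) (z 0 + r / √(1 + m ^ 2)) := by
    simp only [max_lt_iff, lt_min_iff]
    refine ⟨⟨?_, ?_⟩, ?_, ?_⟩ <;> linarith
  convert isJordanArc_graph_Icc (m := m) (q := q) hlt using 1
  ext p
  have hball : p 1 = m * p 0 + q →
      (p ∈ Metric.closedBall z r ↔ |p 0 - z 0| ≤ r / √(1 + m ^ 2)) := by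
    intro h
    rw [Metric.mem_closedBall, EuclideanSpace.dist_eq, Fin.sum_univ_two, Real.dist_eq,
      Real.dist_eq, sq_abs, sq_abs, le_div_iff₀ hpos, h, hz', ← Real.sqrt_sq_eq_abs,
      ← Real.sqrt_mul (sq_nonneg _)]
    congr! 2
    ring
  simp only [lineSegment, Set.mem_inter_iff, Set.mem_ofPred_eq, Set.mem_Icc, max_le_iff, le_min_iff]
  constructor
  · rintro ⟨⟨h1, h2⟩, h3⟩
    rw [hball h2] at h3
    rw [abs_le] at h1 h3
    refine ⟨⟨⟨?_, ?_⟩, ?_, ?_⟩, h2⟩ <;> linarith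
  · rintro ⟨⟨⟨h1, h2⟩, h3, h4⟩, h5⟩
    refine ⟨⟨abs_le.2 ⟨by linarith, by linarith⟩, h5⟩, (hball h5).2 (abs_le.2 ⟨?_, ?_⟩)⟩ <;>
      linarith

/-- The coordinate change of the plane that straightens two lines of distinct slopes to the
coordinate axes. -/
noncomputable def straighten {m m' : ℝ} (h : m ≠ m') (q q' : ℝ) : Plane ≃ₜ Plane where
  toFun p := !₂[p 1 - (m' * p 0 + q'), p 1 - (m * p 0 + q)]
  invFun p := !₂[(p 0 - p 1 - (q - q')) / (m - m'),
    p 1 + (m * ((p 0 - p 1 - (q - q')) / (m - m')) + q)]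
  left_inv p := by
    have : m - m' ≠ 0 := sub_ne_zero.2 h
    ext n
    fin_cases n <;> (simp; field_simp; ring)
  right_inv p := by
    have : m - m' ≠ 0 := sub_ne_zero.2 h
    ext n
    fin_cases n
    · simp
      field_simp
      ring
    · simp
  continuous_toFun := by fun_prop
  continuous_invFun := by fun_prop

theorem lineSegment_inter_and_crossAt {m q c ρ m' q' c' ρ' : ℝ} (hm : m ≠ m') {z : Plane}
    (h : |z 0 - c| < ρ) (h' : |z 0 - c'| < ρ') (hz : z 1 = m * z 0 + q)
    (hz' : z 1 = m' * z 0 + q') :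
    lineSegment m q c ρ ∩ lineSegment m' q' c' ρ' = {z} ∧
      CrossAt (lineSegment m q c ρ) (lineSegment m' q' c' ρ') z := by
  constructor
  · ext p
    rw [Set.mem_singleton_iff]
    constructor
    · rintro ⟨⟨-, h1⟩, -, h2⟩
      have h0 : p 0 = z 0 := by
        have : (m - m') * (p 0 - z 0) = 0 := by linarith
        rcases mul_eq_zero.1 this with h | h
        · exact absurd (sub_eq_zero.1 h) hm
        · linarith
      ext n
      fin_cases n
      · exact h0
      · simp [h1, hz, h0]
    · rintro rfl
      exact ⟨⟨h.le, hz⟩, h'.le, hz'⟩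
  -- Over this open strip both segments coincide with their full lines.
  · have hopen : IsOpen {p : Plane | |p 0 - c| < ρ ∧ |p 0 - c'| < ρ'} := by
      refine IsOpen.and (isOpen_lt ?_ ?_) (isOpen_lt ?_ ?_) <;> fun_prop
    refine ⟨(straighten hm q q').toOpenPartialHomeomorph.restrOpen _ hopen, ⟨trivial, h, h'⟩, ?_, ?_⟩
    · ext n
      fin_cases n
      · simp [straighten, hz']
      · simp [straighten, hz]
    · rintro y ⟨-, hy, hy'⟩
      simp [straighten, lineSegment, hy.le, hy'.le, sub_eq_zero]

/-! ### From label paths to secants -/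

section Labels

variable {W L : Type*}

/-- The vertex set of the path of `T` joining the nodes that carry the two labels of `e`. -/
def labelPath (T : SimpleGraph W) (π : L → W) (e : Sym2 L) : Set W :=
  {w | ∃ (a b : L) (p : T.Walk (π a) (π b)), e = s(a, b) ∧ p.IsPath ∧ w ∈ p.support}

theorem mem_labelPath_iff {T : SimpleGraph W} (hT : T.IsTree) {π : L → W} {i j : L}
    {p : T.Walk (π i) (π j)} (hp : p.IsPath) {w : W} :
    w ∈ labelPath T π s(i, j) ↔ w ∈ p.support := by
  constructor
  · rintro ⟨a, b, q, he, hq, hw⟩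
    rcases Sym2.eq_iff.1 he with ⟨rfl, rfl⟩ | ⟨rfl, rfl⟩
    · rwa [(hT.existsUnique_path _ _).unique hp hq]
    · rw [(hT.existsUnique_path _ _).unique hp hq.reverse]
      simpa using hw
  · exact fun hw => ⟨i, j, p, rfl, hp, hw⟩

/-- Attach every label `i` above the node `π i` as an additional maximal element. -/
abbrev labelledOrder (o : PartialOrder W) (π : L → W) : PartialOrder (W ⊕ L) where
  le
    | .inl a, .inl b => a ≤ b
    | .inl a, .inr i => a ≤ π i
    | .inr _, .inl _ => False
    | .inr i, .inr j => i = j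
  le_refl := by rintro (a | i) <;> simp
  le_trans := by
    rintro (a | i) (b | j) (c | k) <;> simp only [imp_self, implies_true, false_imp_iff]
    · exact le_trans
    · exact le_trans
    · rintro h rfl
      exact h
    · exact Eq.trans
  le_antisymm := by
    rintro (a | i) (b | j) <;> simp only [false_imp_iff, implies_true, Sum.inl.injEq, Sum.inr.injEq]
    · exact le_antisymm
    · exact fun h _ => h

/-- Labels of a finite tree can be placed at real numbers `t i` in such a way that the secants of
the parabola between label positions, restricted to suitable intervals, cross exactly as the paths
between the labels meet. -/
theorem exists_secant_system [Finite W] [Finite L] {T : SimpleGraph W} (hT : T.IsTree)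
    (π : L → W) :
    ∃ (t : L → ℝ) (c ρ : Sym2 L → ℝ), t.Injective ∧ (∀ e, 0 < ρ e) ∧
      (∀ e, ∀ i ∈ e, |t i - c e| < ρ e) ∧
      (∀ i j k l, s(i, j) ≠ s(k, l) →
        (labelPath T π s(i, j) ∩ labelPath T π s(k, l)).Nonempty →
        t i + t j ≠ t k + t l ∧ ∃ x, |x - c s(i, j)| < ρ s(i, j) ∧ |x - c s(k, l)| < ρ s(k, l) ∧
          (t i + t j) * x - t i * t j = (t k + t l) * x - t k * t l) ∧
      (∀ i j k l, ¬ (labelPath T π s(i, j) ∩ labelPath T π s(k, l)).Nonempty →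
        ∀ x, |x - c s(i, j)| ≤ ρ s(i, j) → |x - c s(k, l)| ≤ ρ s(k, l) →
          (t i + t j) * x - t i * t j ≠ (t k + t l) * x - t k * t l) := by
  obtain ⟨r⟩ := hT.connected.nonempty
  let o := hT.rootedOrder r
  let o' := labelledOrder o π
  have htotal : ∀ a b c : W, a ≤ c → b ≤ c → a ≤ b ∨ b ≤ a := fun _ _ _ => hT.ancestor_total
  have htotal' : ∀ a b c : W ⊕ L, a ≤ c → b ≤ c → a ≤ b ∨ b ≤ a := by
    rintro (a | i) (b | j) (c | k) hac hbc
    · exact htotal a b c hac hbc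
    · exact htotal a b (π k) hac hbc
    · exact hbc.elim
    · obtain rfl : j = k := hbc
      exact .inl hac
    · exact hac.elim
    · obtain rfl : i = k := hac
      exact .inr hbc
    · exact hac.elim
    · obtain rfl : i = k := hac
      exact .inr hbc
  have hmax : ∀ i : L, IsMax (Sum.inr i : W ⊕ L) := by
    rintro i (a | j) h
    · exact h.elim
    · exact Eq.symm h
  obtain ⟨τ, R, hR, hnear, hfar, hnest, hsum⟩ := exists_forest_positions (W ⊕ L) htotal'
  have hmeet : ∀ e : Sym2 L, ∃ a : W, ∀ i j, e = s(i, j) →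
      a ≤ π i ∧ a ≤ π j ∧ ∀ d, d ≤ π i → d ≤ π j → d ≤ a := by
    intro e
    induction e with | _ i j
    obtain ⟨a, h1, h2, h3⟩ := hT.exists_isGreatest_ancestor r (π i) (π j)
    refine ⟨a, fun i' j' he => ?_⟩
    rcases Sym2.eq_iff.1 he with ⟨rfl, rfl⟩ | ⟨rfl, rfl⟩
    · exact ⟨h1, h2, h3⟩
    · exact ⟨h2, h1, fun d hd hd' => h3 d hd' hd⟩
  choose a ha using hmeet
  have hpath : ∀ i j w, w ∈ labelPath T π s(i, j) ↔ a s(i, j) ≤ w ∧ (w ≤ π i ∨ w ≤ π j) := by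
    intro i j w
    obtain ⟨p, hp, -⟩ := hT.existsUnique_path (π i) (π j)
    obtain ⟨h1, h2, h3⟩ := ha _ i j rfl
    rw [mem_labelPath_iff hT hp]
    exact hT.mem_support_iff_ancestor h1 h2 h3 hp
  let t : L → ℝ := fun i => τ (.inr i)
  have hpos : ∀ n, 0 < R n := fun n => by linarith [hR n]
  have near : ∀ (d : W) (i : L), d ≤ π i → 4 * |t i - τ (.inl d)| ≤ R (.inl d) ∧
      4 * (t i - τ (.inl d)) ^ 2 < R (.inl d) := fun d i h => hnear (.inl d) (.inr i) h
  have far : ∀ (d : W) (i : L), ¬ d ≤ π i → 8 * R (.inl d) < |t i - τ (.inl d)| :=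
    fun d i h => hfar (.inl d) (.inr i) h
  have nest : ∀ {d b : W}, b < d → ∀ {x : ℝ}, |x - τ (.inl d)| < R (.inl d) →
      |x - τ (.inl b)| < R (.inl b) := by
    intro d b h x hx
    have h' : (Sum.inl b : W ⊕ L) < .inl d := lt_of_le_not_ge h.le h.not_ge
    linarith [hnest _ _ h', abs_sub_le x (τ (.inl d)) (τ (.inl b))]
  have below : ∀ i j k l, a s(k, l) < a s(i, j) →
      (a s(i, j) ≤ π k ∨ a s(i, j) ≤ π l) →
      t i + t j ≠ t k + t l ∧ ∃ x, |x - τ (.inl (a s(i, j)))| < R (.inl (a s(i, j))) ∧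
        |x - τ (.inl (a s(k, l)))| < R (.inl (a s(k, l))) ∧
        (t i + t j) * x - t i * t j = (t k + t l) * x - t k * t l := by
    intro i j k l hlt h
    obtain ⟨hi, hj, -⟩ := ha _ i j rfl
    obtain ⟨-, -, hg⟩ := ha _ k l rfl
    rcases h with h | h
    -- Exactly one of `k`, `l` is above `a s(i, j)`: otherwise that node would be a common ancestor
    -- of both, hence below `a s(k, l)`.
    · have hl : ¬ a s(i, j) ≤ π l := fun hl => hlt.not_ge (hg _ h hl)
      obtain ⟨hne, x, hx, he⟩ := secants_cross_of_near_far (hpos _) (near _ _ hi).1 (near _ _ hj).1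
        (near _ _ h).1 (far _ _ hl)
      exact ⟨hne, x, hx, nest hlt hx, he⟩
    · have hk : ¬ a s(i, j) ≤ π k := fun hk => hlt.not_ge (hg _ hk h)
      obtain ⟨hne, x, hx, he⟩ := secants_cross_of_near_far (hpos _) (near _ _ hi).1 (near _ _ hj).1
        (near _ _ h).1 (far _ _ hk)
      exact ⟨by rwa [add_comm (t k)], x, hx, nest hlt hx, by rw [he]; ring⟩
  refine ⟨t, fun e => τ (.inl (a e)), fun e => R (.inl (a e)), ?_, fun e => hpos _, ?_, ?_, ?_⟩
  · intro i j h
    by_contra hne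
    have := hsum _ _ _ _ (hmax i) (hmax i) (hmax j) (hmax j) (by simpa using hne)
    rw [show τ (.inr i) = τ (.inr j) from h] at this
    norm_num at this
  · intro e i hi
    obtain ⟨j, rfl⟩ := Sym2.mem_iff_exists.1 hi
    linarith [(near _ _ (ha _ i j rfl).1).1, hpos (.inl (a s(i, j))),
      abs_nonneg (t i - τ (.inl (a s(i, j))))]
  · rintro i j k l hne ⟨w, hw, hw'⟩
    rw [hpath] at hw hw'
    -- Both meets are ancestors of the common node `w`, hence comparable, and the higher one lies on
    -- both paths.
    have hcase : (a s(k, l) < a s(i, j) ∧ (a s(i, j) ≤ π k ∨ a s(i, j) ≤ π l)) ∨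
        (a s(i, j) < a s(k, l) ∧ (a s(k, l) ≤ π i ∨ a s(k, l) ≤ π j)) ∨ a s(i, j) = a s(k, l) := by
      rcases htotal _ _ _ hw.1 hw'.1 with h | h
      · rcases h.lt_or_eq with h | h
        · exact .inr (.inl ⟨h, hw.2.imp hw'.1.trans hw'.1.trans⟩)
        · exact .inr (.inr h)
      · rcases h.lt_or_eq with h | h
        · exact .inl ⟨h, hw'.2.imp hw.1.trans hw.1.trans⟩
        · exact .inr (.inr h.symm)
    rcases hcase with ⟨h1, h2⟩ | ⟨h1, h2⟩ | h
    · exact below i j k l h1 h2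
    · obtain ⟨h3, x, h4, h5, h6⟩ := below k l i j h1 h2
      exact ⟨h3.symm, x, h5, h4, h6.symm⟩
    · obtain ⟨hi, hj, -⟩ := ha _ i j rfl
      obtain ⟨hk, hl, -⟩ := ha _ k l rfl
      rw [← h] at hk hl
      obtain ⟨h3, x, h4, h5⟩ := secants_cross_of_near (near _ _ hi).2 (near _ _ hj).2
        (near _ _ hk).2 (near _ _ hl).2
        (hsum _ _ _ _ (hmax i) (hmax j) (hmax k) (hmax l) (by simpa using hne))
      exact ⟨h3, x, h4, by simpa only [← h] using h4, h5⟩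
  · intro i j k l hno x hx hx'
    have hno' : ∀ w, ¬ (w ∈ labelPath T π s(i, j) ∧ w ∈ labelPath T π s(k, l)) :=
      fun w hw => hno ⟨w, hw⟩
    simp only [hpath] at hno'
    obtain ⟨hi, hj, -⟩ := ha _ i j rfl
    obtain ⟨hk, hl, -⟩ := ha _ k l rfl
    -- With comparable meets, a label of the lower path above the higher meet would put that meet on
    -- both paths; so both labels are far.
    by_cases h1 : a s(k, l) ≤ a s(i, j)
    · refine secants_ne_of_near_far_far (hpos _) (near _ _ hi).1 (near _ _ hj).1
        (far _ _ fun h => ?_) (far _ _ fun h => ?_) hx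
      · exact hno' _ ⟨⟨le_rfl, .inl hi⟩, h1, .inl h⟩
      · exact hno' _ ⟨⟨le_rfl, .inl hi⟩, h1, .inr h⟩
    by_cases h2 : a s(i, j) ≤ a s(k, l)
    · refine (secants_ne_of_near_far_far (hpos _) (near _ _ hk).1 (near _ _ hl).1
        (far _ _ fun h => ?_) (far _ _ fun h => ?_) hx').symm
      · exact hno' _ ⟨⟨h2, .inl h⟩, le_rfl, .inl hk⟩
      · exact hno' _ ⟨⟨h2, .inr h⟩, le_rfl, .inl hk⟩
    -- For incomparable meets the two intervals are already disjoint.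
    exfalso
    have f1 := hfar (.inl (a s(k, l))) (.inl (a s(i, j))) h1
    have f2 := hfar (.inl (a s(i, j))) (.inl (a s(k, l))) h2
    have f3 := abs_sub_le (τ (.inl (a s(i, j)))) x (τ (.inl (a s(k, l))))
    rw [abs_sub_comm] at f2
    rw [abs_sub_comm] at hx
    linarith [hpos (.inl (a s(i, j))), hpos (.inl (a s(k, l)))]

end Labels

/-! ### The representation and its disks -/

/-- The pairs of labels of a finite tree are represented by segments, all segments that belong to a
label `k` passing through the centre of a disk that no other segment meets. -/
theorem exists_psiRepresentation_labelPath {W L : Type*} [Finite W] [Finite L]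
    {T : SimpleGraph W} (hT : T.IsTree) (π : L → W) :
    ∃ (s : Sym2 L → Set Plane) (c : L → Plane) (r : L → ℝ),
      IsPSIRepresentation (intersectionGraph (labelPath T π)) s ∧
      (∀ i, 0 < r i) ∧
      (∀ i j, i ≠ j → Disjoint (Metric.closedBall (c i) (r i)) (Metric.closedBall (c j) (r j))) ∧
      (∀ e k, (s e ∩ Metric.closedBall (c k) (r k)).Nonempty ↔ k ∈ e) ∧
      (∀ e, ∀ k ∈ e, IsJordanArc (s e ∩ Metric.closedBall (c k) (r k))) ∧
      (∀ e f k, e ≠ f →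
        (s e ∩ Metric.closedBall (c k) (r k)).Nonempty →
        (s f ∩ Metric.closedBall (c k) (r k)).Nonempty →
        ∃ x ∈ Metric.ball (c k) (r k), x ∈ s e ∩ s f ∧ CrossAt (s e) (s f) x) := by
  obtain ⟨t, c, ρ, ht, hρ, hmem, hcross, hdisj⟩ := exists_secant_system hT π
  let m : Sym2 L → ℝ := Sym2.lift ⟨fun i j => t i + t j, fun i j => add_comm _ _⟩
  let q : Sym2 L → ℝ := Sym2.lift
    ⟨fun i j => -(t i * t j), fun i j => congrArg Neg.neg (mul_comm _ _)⟩
  have hm : ∀ i j, m s(i, j) = t i + t j := fun i j => rfl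
  have hq : ∀ i j, q s(i, j) = -(t i * t j) := fun i j => rfl
  let s : Sym2 L → Set Plane := fun e => lineSegment (m e) (q e) (c e) (ρ e)
  let z : L → Plane := fun i => !₂[t i, t i ^ 2]
  have hz0 : ∀ i, z i 0 = t i := fun i => rfl
  have hz1 : ∀ i, z i 1 = t i ^ 2 := fun i => rfl
  have hzline : ∀ e, ∀ i ∈ e, z i 1 = m e * z i 0 + q e := by
    intro e i hi
    obtain ⟨j, rfl⟩ := Sym2.mem_iff_exists.1 hi
    rw [hz0, hz1, hm, hq]
    ring
  have hzs : ∀ e i, z i ∈ s e ↔ i ∈ e := by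
    intro e i
    refine ⟨?_, fun hi => ⟨(hmem e i hi).le, hzline e i hi⟩⟩
    induction e with | _ j k
    rintro ⟨-, h⟩
    rw [hz0, hz1, hm, hq] at h
    have h' : (t i - t j) * (t i - t k) = 0 := by linarith
    rw [Sym2.mem_iff]
    exact (mul_eq_zero.1 h').imp (fun h => ht (sub_eq_zero.1 h)) fun h => ht (sub_eq_zero.1 h)
  have hmeet : ∀ e f, e ≠ f → (labelPath T π e ∩ labelPath T π f).Nonempty →
      ∃ x, s e ∩ s f = {x} ∧ CrossAt (s e) (s f) x := by
    intro e f hne h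
    induction e with | _ i j
    induction f with | _ k l
    obtain ⟨h1, x, h2, h3, h4⟩ := hcross i j k l hne h
    refine ⟨!₂[x, (t i + t j) * x - t i * t j], lineSegment_inter_and_crossAt h1 h2 h3 ?_ ?_⟩
    · simp [hq, sub_eq_add_neg]
    · simp [hq, h4, sub_eq_add_neg]
  have hnot : ∀ e f, ¬ (labelPath T π e ∩ labelPath T π f).Nonempty → Disjoint (s e) (s f) := by
    intro e f h
    induction e with | _ i j
    induction f with | _ k l
    rw [Set.disjoint_left]
    rintro p ⟨h1, h2⟩ ⟨h3, h4⟩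
    apply hdisj i j k l h (p 0) h1 h3
    rw [hm, hq] at h2 h4
    linarith
  have hshare : ∀ e f k, k ∈ e → k ∈ f → (labelPath T π e ∩ labelPath T π f).Nonempty := by
    have : ∀ e k, k ∈ e → π k ∈ labelPath T π e := by
      intro e k hk
      obtain ⟨j, rfl⟩ := Sym2.mem_iff_exists.1 hk
      obtain ⟨p, hp, -⟩ := hT.existsUnique_path (π k) (π j)
      exact ⟨k, j, p, rfl, hp, p.start_mem_support⟩
    exact fun e f k he hf => ⟨π k, this e k he, this f k hf⟩
  -- Finitely many conditions, each valid for all small positive `r` because the segments are closed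
  -- and the centres distinct.
  obtain ⟨r, hr, hrs, hrz⟩ : ∃ r > 0, (∀ e k, k ∉ e → Disjoint (s e) (Metric.closedBall (z k) r)) ∧
      ∀ i j, i ≠ j → Disjoint (Metric.closedBall (z i) r) (Metric.closedBall (z j) r) := by
    have h1 : ∀ᶠ r in nhdsWithin (0 : ℝ) (Set.Ioi 0), ∀ e k, k ∉ e →
        Disjoint (s e) (Metric.closedBall (z k) r) := by
      simp only [Filter.eventually_all]
      intro e k hk
      obtain ⟨ε, hε, hball⟩ := Metric.isOpen_iff.1
        (isClosed_lineSegment (m e) (q e) (c e) (ρ e)).isOpen_compl (z k) (mt (hzs e k).1 hk)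
      filter_upwards [Ioo_mem_nhdsGT hε] with r hr
      rw [Set.disjoint_right]
      exact fun p hp => hball (Metric.closedBall_subset_ball hr.2 hp)
    have h2 : ∀ᶠ r in nhdsWithin (0 : ℝ) (Set.Ioi 0), ∀ i j, i ≠ j →
        Disjoint (Metric.closedBall (z i) r) (Metric.closedBall (z j) r) := by
      simp only [Filter.eventually_all]
      intro i j hij
      have hne : z i ≠ z j := fun h => hij (ht (by rw [← hz0, ← hz0, h]))
      filter_upwards [Ioo_mem_nhdsGT (half_pos (dist_pos.2 hne))] with r hr
      exact Metric.closedBall_disjoint_closedBall (by linarith [hr.2])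
    obtain ⟨r, ⟨h1, h2⟩, hr⟩ := ((h1.and h2).and self_mem_nhdsWithin).exists
    exact ⟨r, hr, h1, h2⟩
  have hdisk : ∀ e k, (s e ∩ Metric.closedBall (z k) r).Nonempty ↔ k ∈ e := by
    intro e k
    constructor
    · intro h
      by_contra hk
      exact Set.not_disjoint_iff_nonempty_inter.2 h (hrs e k hk)
    · exact fun hk => ⟨z k, (hzs e k).2 hk, Metric.mem_closedBall_self hr.le⟩
  refine ⟨s, z, fun _ => r, ⟨⟨fun e => isJordanArc_lineSegment (hρ e), fun e f hne => ?_⟩, ?_⟩,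
    fun _ => hr, hrz, hdisk, fun e k hk => ?_, fun e f k hne he hf => ?_⟩
  · by_cases h : (labelPath T π e ∩ labelPath T π f).Nonempty
    · exact .inr (hmeet e f hne h)
    · exact .inl (hnot e f h)
  · ext e f
    refine and_congr_right fun hne => ⟨fun h => ?_, fun h => ?_⟩
    · obtain ⟨x, hx, -⟩ := hmeet e f hne h
      exact hx ▸ Set.singleton_nonempty x
    · by_contra h'
      exact Set.not_disjoint_iff_nonempty_inter.2 h (hnot e f h')
  · exact isJordanArc_lineSegment_inter_closedBall hr (hmem e k hk) (hzline e k hk)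
  · rw [hdisk] at he hf
    obtain ⟨x, hx, hcr⟩ := hmeet e f hne (hshare e f k he hf)
    have hzk : z k ∈ s e ∩ s f := ⟨(hzs e k).2 he, (hzs f k).2 hf⟩
    -- Both segments pass through `z k`, so it is their only crossing.
    obtain rfl : z k = x := by rwa [hx] at hzk
    exact ⟨z k, Metric.mem_ball_self hr, hzk, hcr⟩

/-- Every VPT-graph has a PSI-representation. -/
theorem IsVPT.exists_psiRepresentation {V : Type*} [Finite V] {G : SimpleGraph V} (hG : IsVPT G) :
    ∃ s : V → Set Plane, IsPSIRepresentation G s := by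
  obtain ⟨W, _, T, P, hT, hP, rfl⟩ := hG
  choose a b p hp hPp using hP
  -- Each path gets its own two labels, so repeated paths and single-node paths still correspond to
  -- distinct pairs.
  let π : V × Bool → W := fun x => if x.2 then b x.1 else a x.1
  let pair : V → Sym2 (V × Bool) := fun v => s((v, false), (v, true))
  have hpair : Function.Injective pair := by
    intro v w h
    simpa [pair] using h
  have hpath : ∀ v, labelPath T π (pair v) = P v := by
    intro v
    ext w
    rw [hPp]
    exact mem_labelPath_iff (π := π) (i := (v, false)) (j := (v, true)) hT (hp v)
  obtain ⟨s, -, -, ⟨⟨harc, hs⟩, hs'⟩, -⟩ := exists_psiRepresentation_labelPath hT π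
  refine ⟨fun v => s (pair v), ⟨fun v => harc _, fun v w hne => hs _ _ (hpair.ne hne)⟩, ?_⟩
  ext v w
  have := congrArg (fun H : SimpleGraph (Sym2 (V × Bool)) => H.Adj (pair v) (pair w)) hs'
  simpa [intersectionGraph, hpath, hpair.eq_iff] using this

theorem theorem1 :
    (∀ (V : Type*) [Finite V] (G : SimpleGraph V), IsVPT G →
      ∃ s : V → Set Plane, IsPSIRepresentation G s) ∧
    (∀ (W : Type*) [Finite W] (T : SimpleGraph W), T.IsTree →
      ∃ (s : Sym2 (Leaf T) → Set Plane) (c : Leaf T → Plane) (r : Leaf T → ℝ),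
        IsPSIRepresentation (intersectionGraph (leafPath T)) s ∧
        (∀ i, 0 < r i) ∧
        (∀ i j, i ≠ j →
          Disjoint (Metric.closedBall (c i) (r i)) (Metric.closedBall (c j) (r j))) ∧
        (∀ e k, (s e ∩ Metric.closedBall (c k) (r k)).Nonempty ↔ k ∈ e) ∧
        (∀ e, ∀ k ∈ e, IsJordanArc (s e ∩ Metric.closedBall (c k) (r k))) ∧
        (∀ e f k, e ≠ f →
          (s e ∩ Metric.closedBall (c k) (r k)).Nonempty →
          (s f ∩ Metric.closedBall (c k) (r k)).Nonempty →
          ∃ x ∈ Metric.ball (c k) (r k), x ∈ s e ∩ s f ∧ CrossAt (s e) (s f) x)) := by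
  exact ⟨fun V _ G hG => hG.exists_psiRepresentation,
    fun W _ T hT => exists_psiRepresentation_labelPath hT Subtype.val⟩
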